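/- For an irrational number $x\in[0,1]$ let $$x=\cfrac{1}{a_1(x)+\cfrac{1}{a_2(x)+\cfrac{1}{a_3(x)+\cdots}}}$$ be its (infinite, regular) continued fraction expansion, with digits $a_i(x)\in\{1,2,3,\dots\}$, and let $\dim_H$ denote Hausdorff dimension. 1. For every real $\beta\ge 1$, $$\dim_H\{x\in[0,1]\setminus\mathbb{Q} : a_{i+1}(x)\ge \beta\, a_i(x)\ \text{for all } i\ge 1\}=\frac12.$$ 2. For every real $\alpha>1$, $$\dim_H\{x\in[0,1]\setminus\mathbb{Q} : a_{i+1}(x)\ge a_i(x)^{\alpha}\ \text{for all } i\ge 1\}=\frac{1}{1+\alpha}.$$ -/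

import Mathlib

/-- The continued fraction digit `a_{i+1}(x)` of `x`, numbered from `i = 0`: for
`x = [a₀; a₁, a₂, a₃, …]` we have `cfDigit x 0 = a₁`, `cfDigit x 1 = a₂`, and so on.
The default value `0` is used only when the expansion is finite and too short, hence
never for irrational `x`, see `cfDigit_spec`. -/
noncomputable def cfDigit (x : ℝ) (i : ℕ) : ℝ :=
  ((GenContFract.of x).partDens.get? i).getD 0

/-- For irrational `x` every digit comes from the expansion of `x`. -/
theorem cfDigit_spec {x : ℝ} (hx : Irrational x) (i : ℕ) :
    (GenContFract.of x).partDens.get? i = some (cfDigit x i) := by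
  have h : (GenContFract.of x).partDens.get? i ≠ none := by
    intro h
    have ht : (GenContFract.of x).Terminates :=
      ⟨i, GenContFract.terminatedAt_iff_partDen_none.2 h⟩
    obtain ⟨q, hq⟩ := (GenContFract.terminates_iff_rat x).1 ht
    exact hx ⟨q, hq.symm⟩
  obtain ⟨b, hb⟩ := Option.ne_none_iff_exists'.1 h
  simp [cfDigit, hb]

open Set MeasureTheory Filter Topology
open scoped ENNReal NNReal

/-! Both parts reduce to two estimates, for growth `d i ^ α ≤ d (i + 1)` with `α ≥ 1`; the condition
with factor `β ≥ 1` implies the case `α = 1`.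

Upper bound (`dimH_digitSet_rpow_le`): the digits are nondecreasing, so they are eventually constant
or some digit is at least a large `M`. The first case gives a countable set. In the second, a tail
whose preceding digit is `m` fits in an interval of length `m ^ (-α)`. Prepending a digit `a`
contracts by `a ^ (-2)`, and refining the cover over all `a ≥ m ^ α` does not increase its
`s`-dimensional size once the sum of `a ^ (-s(1 + α))` over `a ≥ M` is at most 1. Such an `M` exists
for every `s > 1 / (1 + α)`.

Lower bound (`le_dimH_of_growth`): let the `n`-th digit range freely over `[s n, 2 * s n)`, where `s
(n + 1)` is about a constant times `s n ^ α`. Reading these digits as mixed radix digits maps the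
resulting set onto `[0, 1)`, and this map is Hölder of every exponent `t < 1 / (1 + α)` once `s 0`
is large (`abs_sub_le_cfEncode`). Hence the dimension is at least `t`. -/

/-- The irrational numbers in the open unit interval. -/
def unitIrr : Set ℝ := {x | x ∈ Ioo (0 : ℝ) 1 ∧ Irrational x}

theorem mem_unitIrr_of_mem_Icc {x : ℝ} (hx : x ∈ Icc (0 : ℝ) 1) (hi : Irrational x) :
    x ∈ unitIrr :=
  ⟨⟨lt_of_le_of_ne hx.1 hi.ne_zero.symm, lt_of_le_of_ne hx.2 hi.ne_one⟩, hi⟩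

/-! ### Digits of a number and their uniqueness. -/

theorem cfDigit_eq_of_get? {x : ℝ} {i : ℕ} {p : GenContFract.Pair ℝ}
    (h : (GenContFract.of x).s.get? i = some p) : cfDigit x i = p.b := by
  simp [cfDigit, GenContFract.partDen_eq_s_b h]

theorem cfDigit_zero {x : ℝ} (h : Int.fract x ≠ 0) : cfDigit x 0 = ⌊(Int.fract x)⁻¹⌋ :=
  cfDigit_eq_of_get? (GenContFract.of_s_head h)

theorem cfDigit_succ (x : ℝ) (i : ℕ) : cfDigit x (i + 1) = cfDigit (Int.fract x)⁻¹ i := by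
  simp only [cfDigit, GenContFract.partDens, Stream'.Seq.map_get?, GenContFract.of_s_succ]

theorem cfDigit_fract {x : ℝ} (h : Int.fract x ≠ 0) (i : ℕ) :
    cfDigit (Int.fract x) i = cfDigit x i := by
  cases i with
  | zero => rw [cfDigit_zero h, cfDigit_zero (by simpa using h), Int.fract_fract]
  | succ i => rw [cfDigit_succ, cfDigit_succ, Int.fract_fract]

/-- Splitting off the first digit of a continued fraction. -/
theorem exists_cfDigit_cons {x : ℝ} (hx : x ∈ unitIrr) :
    ∃ a : ℕ, 1 ≤ a ∧ cfDigit x 0 = a ∧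
      ∃ y ∈ unitIrr, x = ((a : ℝ) + y)⁻¹ ∧ ∀ i, cfDigit x (i + 1) = cfDigit y i := by
  obtain ⟨⟨h0, h1⟩, hi⟩ := hx
  have hfx : Int.fract x = x := Int.fract_eq_self.2 ⟨h0.le, h1⟩
  have h1' : 1 ≤ x⁻¹ := (one_lt_inv₀ h0).2 h1 |>.le
  have hfl : 1 ≤ ⌊x⁻¹⌋ := Int.le_floor.2 (by simpa using h1')
  have hcast : ((⌊x⁻¹⌋.toNat : ℕ) : ℝ) = (⌊x⁻¹⌋ : ℝ) := by
    have : ((⌊x⁻¹⌋.toNat : ℕ) : ℤ) = ⌊x⁻¹⌋ := Int.toNat_of_nonneg (by omega)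
    exact_mod_cast this
  have hfi : Irrational (Int.fract x⁻¹) := by
    have : Irrational x⁻¹ := irrational_inv_iff.2 hi
    rw [Int.fract]; exact this.sub_intCast _
  refine ⟨⌊x⁻¹⌋.toNat, by omega, ?_, Int.fract x⁻¹,
    ⟨⟨lt_of_le_of_ne (Int.fract_nonneg _) hfi.ne_zero.symm, Int.fract_lt_one _⟩, hfi⟩, ?_, ?_⟩
  · rw [cfDigit_zero (by rw [hfx]; exact h0.ne'), hfx, hcast]
  · rw [hcast, Int.floor_add_fract, inv_inv]
  · intro i
    rw [cfDigit_fract hfi.ne_zero, cfDigit_succ, hfx]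

theorem abs_inv_add_sub_inv_add {a b x y : ℝ} (hx : 0 < a + x) (hy : 0 < b + y) :
    |(a + x)⁻¹ - (b + y)⁻¹| = |(a - b) + (x - y)| / ((a + x) * (b + y)) := by
  rw [inv_sub_inv hx.ne' hy.ne', abs_div, abs_of_pos (mul_pos hx hy), abs_sub_comm]
  congr 2; ring

/-- Digits are removed in pairs: with first digit 1 a single step need not contract uniformly, but
two steps always contract by a factor of at least 4. -/
theorem abs_sub_le_of_cfDigit_eq (n : ℕ) : ∀ x ∈ unitIrr, ∀ y ∈ unitIrr,
    (∀ i, cfDigit x i = cfDigit y i) → |x - y| ≤ (1 / 4) ^ n := by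
  induction n with
  | zero =>
    intro x hx y hy _
    rw [abs_le]; constructor <;> norm_num <;> linarith [hx.1.1, hx.1.2, hy.1.1, hy.1.2]
  | succ n ih =>
    intro x hx y hy h
    obtain ⟨a, ha, hxa, u, hu, rfl, hux⟩ := exists_cfDigit_cons hx
    obtain ⟨a', ha', hya, v, hv, rfl, hvy⟩ := exists_cfDigit_cons hy
    obtain ⟨b, hb, hub, z, hz, rfl, hzu⟩ := exists_cfDigit_cons hu
    obtain ⟨b', hb', hvb, w, hw, rfl, hwv⟩ := exists_cfDigit_cons hv
    obtain rfl : a = a' := by exact_mod_cast hxa.symm.trans ((h 0).trans hya)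
    obtain rfl : b = b' := by
      exact_mod_cast hub.symm.trans ((hux 0).symm.trans ((h 1).trans ((hvy 0).trans hvb)))
    have key := ih z hz w hw fun i => by rw [← hzu, ← hux, h, hvy, hwv]
    have ha1 : (1 : ℝ) ≤ a := by exact_mod_cast ha
    have hb1 : (1 : ℝ) ≤ b := by exact_mod_cast hb
    have hz0 := hz.1.1
    have hw0 := hw.1.1
    have p1 : 0 < (b : ℝ) + z := by linarith
    have p2 : 0 < (b : ℝ) + w := by linarith
    rw [abs_inv_add_sub_inv_add (by positivity) (by positivity), sub_self, zero_add,
      abs_inv_add_sub_inv_add p1 p2, sub_self, zero_add, div_div]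
    have e : ((b : ℝ) + z) * (b + w) * ((a + ((b : ℝ) + z)⁻¹) * (a + ((b : ℝ) + w)⁻¹))
        = (a * (b + z) + 1) * (a * (b + w) + 1) := by
      field_simp
    rw [e, div_le_iff₀ (by positivity), pow_succ]
    have q1 : 2 ≤ a * ((b : ℝ) + z) + 1 := by nlinarith
    have q2 : 2 ≤ a * ((b : ℝ) + w) + 1 := by nlinarith
    have q3 : 4 ≤ (a * ((b : ℝ) + z) + 1) * (a * ((b : ℝ) + w) + 1) := by nlinarith
    have : (0 : ℝ) ≤ (1 / 4) ^ n := by positivity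
    nlinarith

/-- The digits determine an irrational number of the unit interval. -/
theorem eq_of_cfDigit_eq {x y : ℝ} (hx : x ∈ unitIrr) (hy : y ∈ unitIrr)
    (h : ∀ i, cfDigit x i = cfDigit y i) : x = y := by
  have h1 : |x - y| ≤ 0 := by
    refine ge_of_tendsto' (tendsto_pow_atTop_nhds_zero_of_lt_one (r := (1 / 4 : ℝ)) (by norm_num)
      (by norm_num)) fun n => abs_sub_le_of_cfDigit_eq n x hx y hy h
  exact sub_eq_zero.1 (abs_nonpos_iff.1 h1)

/-! ### Continued fractions with prescribed digits. -/

/-- Finite continued fractions with prescribed digits. -/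
noncomputable def cfFinite : ℕ → (ℕ → ℕ) → ℝ
  | 0, _ => 0
  | n + 1, a => ((a 0 : ℝ) + cfFinite n fun i => a (i + 1))⁻¹

theorem cfFinite_succ (n : ℕ) (a : ℕ → ℕ) :
    cfFinite (n + 1) a = ((a 0 : ℝ) + cfFinite n fun i => a (i + 1))⁻¹ := rfl

theorem cfFinite_nonneg (n : ℕ) (a : ℕ → ℕ) : 0 ≤ cfFinite n a := by
  induction n generalizing a with
  | zero => exact le_rfl
  | succ n ih =>
    have := ih fun i => a (i + 1)
    rw [cfFinite]; positivity

/-- With digits at least 2 a single step already contracts by 4. Only such digits occur in the lower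
bound. -/
theorem abs_cfFinite_succ_sub_le (n : ℕ) : ∀ a : ℕ → ℕ, (∀ i, 2 ≤ a i) →
    dist (cfFinite n a) (cfFinite (n + 1) a) ≤ 1 * (1 / 4) ^ n := by
  induction n with
  | zero =>
    intro a ha
    have h2 : (2 : ℝ) ≤ a 0 := by exact_mod_cast ha 0
    simp only [cfFinite, Real.dist_eq, zero_sub, abs_neg, add_zero, pow_zero, mul_one]
    rw [abs_of_nonneg (by positivity)]
    exact inv_le_one_of_one_le₀ (by linarith)
  | succ n ih =>
    intro a ha
    have h2 : (2 : ℝ) ≤ a 0 := by exact_mod_cast ha 0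
    have h := ih (fun i => a (i + 1)) fun i => ha (i + 1)
    have n1 := cfFinite_nonneg n fun i => a (i + 1)
    have n2 := cfFinite_nonneg (n + 1) fun i => a (i + 1)
    rw [cfFinite_succ n, cfFinite_succ (n + 1), Real.dist_eq,
      abs_inv_add_sub_inv_add (by positivity) (by positivity), sub_self, zero_add,
      ← Real.dist_eq, div_le_iff₀ (by positivity), pow_succ]
    have q : 4 ≤ ((a 0 : ℝ) + cfFinite n fun i => a (i + 1)) *
        (a 0 + cfFinite (n + 1) fun i => a (i + 1)) := by nlinarith
    have : (0 : ℝ) ≤ (1 / 4) ^ n := by positivity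
    nlinarith

/-- The infinite continued fraction with prescribed digits. -/
noncomputable def cfValue (a : ℕ → ℕ) : ℝ := limUnder atTop fun n => cfFinite n a

theorem tendsto_cfFinite {a : ℕ → ℕ} (ha : ∀ i, 2 ≤ a i) :
    Tendsto (fun n => cfFinite n a) atTop (𝓝 (cfValue a)) :=
  (cauchySeq_of_le_geometric (1 / 4) 1 (by norm_num)
    fun n => abs_cfFinite_succ_sub_le n a ha).tendsto_limUnder

theorem cfValue_nonneg {a : ℕ → ℕ} (ha : ∀ i, 2 ≤ a i) : 0 ≤ cfValue a :=
  ge_of_tendsto' (tendsto_cfFinite ha) fun n => cfFinite_nonneg n a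

theorem cfValue_eq {a : ℕ → ℕ} (ha : ∀ i, 2 ≤ a i) :
    cfValue a = ((a 0 : ℝ) + cfValue fun i => a (i + 1))⁻¹ := by
  have h2 : (2 : ℝ) ≤ a 0 := by exact_mod_cast ha 0
  have hn := cfValue_nonneg fun i => ha (i + 1)
  refine tendsto_nhds_unique ((tendsto_add_atTop_iff_nat 1).2 (tendsto_cfFinite ha)) ?_
  exact (tendsto_const_nhds.add (tendsto_cfFinite fun i => ha (i + 1))).inv₀ (by positivity)

theorem cfValue_pos {a : ℕ → ℕ} (ha : ∀ i, 2 ≤ a i) : 0 < cfValue a := by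
  have h2 : (2 : ℝ) ≤ a 0 := by exact_mod_cast ha 0
  have hn := cfValue_nonneg fun i => ha (i + 1)
  rw [cfValue_eq ha]; positivity

theorem cfValue_le_half {a : ℕ → ℕ} (ha : ∀ i, 2 ≤ a i) : cfValue a ≤ 1 / 2 := by
  have h2 : (2 : ℝ) ≤ a 0 := by exact_mod_cast ha 0
  have hn := cfValue_nonneg fun i => ha (i + 1)
  rw [cfValue_eq ha, one_div]
  exact inv_anti₀ (by norm_num) (by linarith)

theorem of_cfValue_get? (n : ℕ) : ∀ a : ℕ → ℕ, (∀ i, 2 ≤ a i) →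
    (GenContFract.of (cfValue a)).s.get? n = some ⟨1, (a n : ℝ)⟩ := by
  have fr : ∀ a : ℕ → ℕ, (∀ i, 2 ≤ a i) → Int.fract (cfValue a) = cfValue a := fun a ha =>
    Int.fract_eq_self.2 ⟨cfValue_nonneg ha, by linarith [cfValue_le_half ha]⟩
  induction n with
  | zero =>
    intro a ha
    have h := GenContFract.of_s_head (v := cfValue a) (by rw [fr a ha]; exact (cfValue_pos ha).ne')
    change (GenContFract.of (cfValue a)).s.get? 0 = _ at h
    rw [h, fr a ha, cfValue_eq ha, inv_inv]
    have hf : ⌊(a 0 : ℝ) + cfValue fun i => a (i + 1)⌋ = (a 0 : ℤ) := by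
      rw [Int.floor_eq_iff]
      have h1 := cfValue_nonneg fun i => ha (i + 1)
      have h2 := cfValue_le_half fun i => ha (i + 1)
      constructor <;> push_cast <;> linarith
    rw [hf]; simp
  | succ n ih =>
    intro a ha
    have ht : ∀ i, 2 ≤ a (i + 1) := fun i => ha (i + 1)
    have e : (Int.fract (cfValue a))⁻¹ = cfValue (fun i => a (i + 1)) + (a 0 : ℤ) := by
      rw [fr a ha, cfValue_eq ha, inv_inv]; push_cast; ring
    rw [GenContFract.of_s_succ, e]
    have := ih _ ht
    -- The expansion beyond the integer part depends only on the fractional part, so the summand `a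
    -- 0` can be dropped.
    cases n with
    | zero =>
      have hne : Int.fract (cfValue fun i => a (i + 1)) ≠ 0 := by
        rw [fr _ ht]; exact (cfValue_pos ht).ne'
      have h1 := GenContFract.of_s_head hne
      have h2 := GenContFract.of_s_head
        (v := (cfValue fun i => a (i + 1)) + (a 0 : ℤ)) (by rwa [Int.fract_add_intCast])
      rw [Int.fract_add_intCast] at h2
      exact h2.trans (h1.symm.trans this)
    | succ n =>
      rw [GenContFract.of_s_succ] at this ⊢
      rwa [Int.fract_add_intCast]

theorem cfDigit_cfValue {a : ℕ → ℕ} (ha : ∀ i, 2 ≤ a i) (n : ℕ) : cfDigit (cfValue a) n = a n :=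
  cfDigit_eq_of_get? (of_cfValue_get? n a ha)

theorem cfValue_mem_unitIrr {a : ℕ → ℕ} (ha : ∀ i, 2 ≤ a i) : cfValue a ∈ unitIrr := by
  refine ⟨⟨cfValue_pos ha, by linarith [cfValue_le_half ha]⟩, ?_⟩
  rintro ⟨q, hq⟩
  obtain ⟨n, hn⟩ := (GenContFract.terminates_iff_rat (cfValue a)).2 ⟨q, hq.symm⟩
  have h : (GenContFract.of (cfValue a)).s.get? n = none := hn
  rw [of_cfValue_get? n a ha] at h
  exact absurd h (by simp)

/-! ### Upper bound: covers of the power growth sets. -/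

theorem ediam_image_inv_add_le {a : ℕ} (ha : 1 ≤ a) {t : Set ℝ} (ht : t ⊆ Ici 0) :
    Metric.ediam ((fun y : ℝ => ((a : ℝ) + y)⁻¹) '' t) ≤
      ENNReal.ofReal ((a : ℝ) ^ (-2 : ℝ)) * Metric.ediam t := by
  have ha1 : (1 : ℝ) ≤ a := by exact_mod_cast ha
  refine Metric.ediam_image_le_iff.2 fun x hx y hy => ?_
  refine le_trans ?_ (mul_le_mul_right (Metric.edist_le_ediam_of_mem hx hy) _)
  have hx0 : 0 ≤ x := ht hx
  have hy0 : 0 ≤ y := ht hy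
  rw [edist_dist, edist_dist, ← ENNReal.ofReal_mul (by positivity)]
  refine ENNReal.ofReal_le_ofReal ?_
  rw [Real.dist_eq, abs_inv_add_sub_inv_add (by positivity) (by positivity), sub_self, zero_add,
    Real.dist_eq, Real.rpow_neg (by positivity), Real.rpow_ofNat, div_eq_inv_mul]
  gcongr
  nlinarith

theorem dimH_image_inv_add_le {a : ℕ} (ha : 1 ≤ a) {t : Set ℝ} (ht : t ⊆ Ici 0) :
    dimH ((fun y : ℝ => ((a : ℝ) + y)⁻¹) '' t) ≤ dimH t := by
  have ha1 : (1 : ℝ) ≤ a := by exact_mod_cast ha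
  refine LipschitzOnWith.dimH_image_le (K := 1) (LipschitzOnWith.of_dist_le_mul fun x hx y hy => ?_)
  have hx0 : 0 ≤ x := ht hx
  have hy0 : 0 ≤ y := ht hy
  rw [Real.dist_eq, abs_inv_add_sub_inv_add (by positivity) (by positivity), sub_self, zero_add,
    Real.dist_eq, NNReal.coe_one, one_mul]
  refine div_le_self (abs_nonneg _) ?_
  nlinarith

/-- Irrational numbers of the unit interval whose digit sequence has a given property. -/
def digitSet (Q : (ℕ → ℝ) → Prop) : Set ℝ := {x | x ∈ unitIrr ∧ Q (cfDigit x)}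

theorem digitSet_subset_Ici (Q : (ℕ → ℝ) → Prop) : digitSet Q ⊆ Ici 0 := fun _ hx => hx.1.1.1.le

/-- Requiring a property of a tail of the digits only does not increase the dimension. -/
theorem dimH_digitSet_tail_le (Q : (ℕ → ℝ) → Prop) (k : ℕ) :
    dimH (digitSet fun d => Q fun i => d (i + k)) ≤ dimH (digitSet Q) := by
  induction k with
  | zero => exact le_rfl
  | succ k ih =>
    -- One unconstrained leading digit gives a countable union of 1-Lipschitz images.
    refine le_trans (dimH_mono (t := ⋃ a : ℕ, (fun y : ℝ => (((a + 1 : ℕ) : ℝ) + y)⁻¹) ''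
      digitSet fun d => Q fun i => d (i + k)) ?_) ?_
    · rintro x ⟨hx, hQ⟩
      obtain ⟨a, ha, -, y, hy, rfl, h⟩ := exists_cfDigit_cons hx
      obtain ⟨a, rfl⟩ := Nat.exists_eq_add_of_le' ha
      refine mem_iUnion.2 ⟨a, y, ⟨hy, ?_⟩, rfl⟩
      convert hQ using 2 with i
      rw [← h]; rfl
    · rw [dimH_iUnion]
      exact iSup_le fun a =>
        (dimH_image_inv_add_le (by omega) (digitSet_subset_Ici _)).trans ih

theorem dimH_digitSet_const (c : ℝ) : dimH (digitSet fun d => ∀ i, d i = c) = 0 :=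
  dimH_subsingleton fun _ hx _ hy => eq_of_cfDigit_eq hx.1 hy.1 fun i => by rw [hx.2, hy.2]

/-- The power growth condition on digit sequences, with first digit bounded below. -/
def PowerGrowth (α : ℝ) (m : ℕ) (d : ℕ → ℝ) : Prop :=
  (m : ℝ) ^ α ≤ d 0 ∧ ∀ i, d i ^ α ≤ d (i + 1)

/-- In `PowerGrowth` the number `m` plays the previous digit, so removing the first digit `a` leaves
the same condition with `a` for `m`. -/
theorem digitSet_powerGrowth_subset (α : ℝ) (m : ℕ) :
    digitSet (PowerGrowth α m) ⊆ ⋃ a : {a : ℕ // (m : ℝ) ^ α ≤ a ∧ 1 ≤ a},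
      (fun y : ℝ => ((a : ℕ) + y)⁻¹) '' digitSet (PowerGrowth α a) := by
  rintro x ⟨hx, h0, hs⟩
  obtain ⟨a, ha, hxa, y, hy, rfl, h⟩ := exists_cfDigit_cons hx
  refine mem_iUnion.2 ⟨⟨a, hxa ▸ h0, ha⟩, y, ⟨hy, ?_, fun i => ?_⟩, rfl⟩
  · rw [← hxa, ← h]; exact hs 0
  · rw [← h, ← h]; exact hs (i + 1)

theorem le_of_rpow_le {α : ℝ} (hα : 1 ≤ α) {m a : ℕ} (h1 : 1 ≤ m) (h : (m : ℝ) ^ α ≤ a) :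
    m ≤ a := by
  have : (m : ℝ) ≤ (m : ℝ) ^ α := Real.self_le_rpow_of_one_le (by exact_mod_cast h1) hα
  exact_mod_cast this.trans h

theorem ediam_digitSet_powerGrowth_le {α : ℝ} {m : ℕ} (hm : 1 ≤ m) :
    Metric.ediam (digitSet (PowerGrowth α m)) ≤ ENNReal.ofReal ((m : ℝ) ^ (-α)) := by
  have hm0 : (0 : ℝ) < m := by exact_mod_cast hm
  refine (Metric.ediam_mono (t := Icc 0 ((m : ℝ) ^ (-α))) ?_).trans (by rw [Real.ediam_Icc, sub_zero])
  rintro x ⟨hx, h0, -⟩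
  obtain ⟨a, ha, hxa, y, hy, rfl, -⟩ := exists_cfDigit_cons hx
  refine ⟨hx.1.1.le, ?_⟩
  rw [Real.rpow_neg hm0.le]
  rw [hxa] at h0
  exact inv_anti₀ (by positivity) (by linarith [hy.1.1])

/-- Efficient covers of the power growth sets: the total `s`-dimensional size of the cover does not
grow with its depth `n`. -/
theorem exists_cover_digitSet_powerGrowth {α s : ℝ} (hα : 1 ≤ α) (hs : 0 ≤ s) {M : ℕ} (hM : 2 ≤ M)
    (hsum : ∑' a : ℕ, (if M ≤ a then ENNReal.ofReal ((a : ℝ) ^ (-(s * (1 + α)))) else 0) ≤ 1)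
    (n : ℕ) : ∀ m : ℕ, M ≤ m → ∃ (ι : Type) (_ : Countable ι) (t : ι → Set ℝ),
      digitSet (PowerGrowth α m) ⊆ ⋃ i, t i ∧ (∀ i, t i ⊆ Ici 0) ∧
      (∀ i, Metric.ediam (t i) ≤ ENNReal.ofReal ((1 / 4) ^ n)) ∧
      ∑' i, Metric.ediam (t i) ^ s ≤ ENNReal.ofReal ((m : ℝ) ^ (-(α * s))) := by
  induction n with
  | zero =>
    intro m hm
    have hm0 : (1 : ℝ) ≤ m := by exact_mod_cast (by omega : 1 ≤ m)
    have hd := ediam_digitSet_powerGrowth_le (α := α) (m := m) (by omega)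
    refine ⟨Unit, inferInstance, fun _ => digitSet (PowerGrowth α m), subset_iUnion_of_subset () le_rfl,
      fun _ => digitSet_subset_Ici _, fun _ => hd.trans (ENNReal.ofReal_le_ofReal ?_), ?_⟩
    · rw [pow_zero]; exact Real.rpow_le_one_of_one_le_of_nonpos hm0 (by linarith)
    · rw [tsum_fintype, Fintype.sum_unique]
      refine (ENNReal.rpow_le_rpow hd hs).trans_eq ?_
      rw [ENNReal.ofReal_rpow_of_nonneg (by positivity) hs, ← Real.rpow_mul (by positivity), neg_mul]
  | succ n ih =>
    intro m hm
    have hm1 : (1 : ℝ) ≤ m := by exact_mod_cast (by omega : 1 ≤ m)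
    have hle : ∀ a : {a : ℕ // (m : ℝ) ^ α ≤ a ∧ 1 ≤ a}, M ≤ (a : ℕ) := fun a =>
      hm.trans (le_of_rpow_le hα (by omega) a.2.1)
    choose ι hι t hcov hpos hdiam hsz using fun a : {a : ℕ // (m : ℝ) ^ α ≤ a ∧ 1 ≤ a} =>
      ih a (hle a)
    refine ⟨Σ a, ι a, inferInstance,
      fun p => (fun y : ℝ => (((p.1 : ℕ) : ℝ) + y)⁻¹) '' t p.1 p.2, ?_, ?_, ?_, ?_⟩
    · refine (digitSet_powerGrowth_subset α m).trans (iUnion_subset fun a => ?_)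
      rintro _ ⟨y, hy, rfl⟩
      obtain ⟨i, hi⟩ := mem_iUnion.1 (hcov a hy)
      exact mem_iUnion.2 ⟨⟨a, i⟩, y, hi, rfl⟩
    · rintro ⟨a, i⟩ _ ⟨y, hy, rfl⟩
      have : 0 ≤ y := hpos a i hy
      exact mem_Ici.2 (by positivity)
    · rintro ⟨a, i⟩
      refine (ediam_image_inv_add_le a.2.2 (hpos a i)).trans ?_
      have h2 : (2 : ℝ) ≤ (a : ℕ) := by exact_mod_cast hM.trans (hle a)
      refine (mul_le_mul_right (hdiam a i) _).trans ?_
      rw [← ENNReal.ofReal_mul (by positivity), pow_succ' (1 / 4 : ℝ)]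
      refine ENNReal.ofReal_le_ofReal (mul_le_mul_of_nonneg_right ?_ (by positivity))
      rw [Real.rpow_neg (by positivity), Real.rpow_ofNat, one_div]
      exact inv_anti₀ (by norm_num) (by nlinarith)
    · have hterm : ∀ a : {a : ℕ // (m : ℝ) ^ α ≤ a ∧ 1 ≤ a},
          ∑' i, Metric.ediam ((fun y : ℝ => ((a : ℕ) + y)⁻¹) '' t a i) ^ s ≤
            ENNReal.ofReal ((m : ℝ) ^ (-(α * s))) *
              (if M ≤ (a : ℕ) then ENNReal.ofReal (((a : ℕ) : ℝ) ^ (-(s * (1 + α)))) else 0) := by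
        intro a
        have ha0 : (0 : ℝ) < (a : ℕ) := by exact_mod_cast a.2.2
        rw [if_pos (hle a)]
        calc _ ≤ ∑' i, ENNReal.ofReal (((a : ℕ) : ℝ) ^ (-2 * s)) * Metric.ediam (t a i) ^ s := by
              refine ENNReal.tsum_le_tsum fun i => ?_
              refine (ENNReal.rpow_le_rpow (ediam_image_inv_add_le a.2.2 (hpos a i)) hs).trans_eq ?_
              rw [ENNReal.mul_rpow_of_nonneg _ _ hs, ENNReal.ofReal_rpow_of_nonneg (by positivity) hs,
                ← Real.rpow_mul ha0.le]
          _ ≤ ENNReal.ofReal (((a : ℕ) : ℝ) ^ (-2 * s)) *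
                ENNReal.ofReal (((a : ℕ) : ℝ) ^ (-(α * s))) := by
              rw [ENNReal.tsum_mul_left]
              exact mul_le_mul_right (hsz a) _
          _ ≤ _ := by
              rw [← ENNReal.ofReal_mul (by positivity), ← ENNReal.ofReal_mul (by positivity)]
              refine ENNReal.ofReal_le_ofReal ?_
              -- The factor `a ^ (-s)` is at most `m ^ (-(α * s))` because `a ≥ m ^ α`; the
              -- remaining factor is summed by `hsum`.
              have e : ((a : ℕ) : ℝ) ^ (-2 * s) * ((a : ℕ) : ℝ) ^ (-(α * s)) =
                  ((a : ℕ) : ℝ) ^ (-s) * ((a : ℕ) : ℝ) ^ (-(s * (1 + α))) := by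
                rw [← Real.rpow_add ha0, ← Real.rpow_add ha0]; congr 1; ring
              rw [e]
              refine mul_le_mul_of_nonneg_right ?_ (by positivity)
              rw [← mul_neg, Real.rpow_mul (by positivity)]
              exact Real.rpow_le_rpow_of_nonpos (by positivity) a.2.1 (by linarith)
      rw [ENNReal.tsum_sigma']
      refine (ENNReal.tsum_le_tsum hterm).trans ?_
      rw [ENNReal.tsum_mul_left]
      refine (mul_le_mul_right ((ENNReal.tsum_comp_le_tsum_of_injective Subtype.val_injective
        fun a : ℕ => if M ≤ a then ENNReal.ofReal ((a : ℝ) ^ (-(s * (1 + α)))) else 0).trans hsum)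
        _).trans_eq (mul_one _)

theorem dimH_digitSet_powerGrowth_le {α : ℝ} {s : ℝ≥0} (hα : 1 ≤ α) {M : ℕ} (hM : 2 ≤ M)
    (hsum : ∑' a : ℕ, (if M ≤ a then ENNReal.ofReal ((a : ℝ) ^ (-(s * (1 + α)))) else 0) ≤ 1)
    {m : ℕ} (hm : M ≤ m) : dimH (digitSet (PowerGrowth α m)) ≤ s := by
  choose ι hι t hcov _ hdiam hsz using fun n =>
    exists_cover_digitSet_powerGrowth hα s.2 hM hsum n m hm
  refine dimH_le_of_hausdorffMeasure_ne_top (ne_top_of_le_ne_top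
    (ENNReal.ofReal_ne_top (r := (m : ℝ) ^ (-(α * s)))) ?_)
  refine (Measure.hausdorffMeasure_le_liminf_tsum (l := atTop) (s : ℝ) _
    (fun n => ENNReal.ofReal ((1 / 4) ^ n)) ?_ t (Eventually.of_forall hdiam)
    (Eventually.of_forall hcov)).trans ?_
  · rw [← ENNReal.ofReal_zero]
    exact ENNReal.tendsto_ofReal
      (tendsto_pow_atTop_nhds_zero_of_lt_one (by norm_num) (by norm_num))
  · exact liminf_le_of_le (by isBoundedDefault) fun b hb => by
      obtain ⟨n, hn⟩ := hb.exists
      exact hn.trans (hsz n)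

theorem exists_tsum_rpow_tail_le_one {p : ℝ} (hp : 1 < p) : ∃ M : ℕ, 2 ≤ M ∧
    ∑' a : ℕ, (if M ≤ a then ENNReal.ofReal ((a : ℝ) ^ (-p)) else 0) ≤ 1 := by
  have hfin : ∑' a : ℕ, ENNReal.ofReal ((a : ℝ) ^ (-p)) ≠ ∞ := by
    rw [← ENNReal.ofReal_tsum_of_nonneg (fun a => by positivity)
      (Real.summable_nat_rpow.2 (by linarith))]
    exact ENNReal.ofReal_ne_top
  have ht := ENNReal.tendsto_tsum_compl_atTop_zero hfin
  obtain ⟨F, hF⟩ := (ht.eventually (gt_mem_nhds one_pos)).exists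
  refine ⟨max 2 (F.sup id + 1), le_max_left _ _, le_trans (le_trans ?_
    (tsum_subtype {a | a ∉ F} fun a : ℕ => ENNReal.ofReal ((a : ℝ) ^ (-p))).ge) hF.le⟩
  refine ENNReal.tsum_le_tsum fun a => ?_
  split_ifs with h
  · have : a ∉ F := fun ha => by
      have h1 : a ≤ F.sup id := Finset.le_sup (f := id) ha
      have h2 := (le_max_right _ _).trans h
      omega
    rw [indicator_of_mem (show a ∈ {a | a ∉ F} from this)]
  · exact zero_le

theorem exists_nat_cfDigit_eq {x : ℝ} (hx : x ∈ unitIrr) (i : ℕ) :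
    ∃ a : ℕ, 1 ≤ a ∧ cfDigit x i = a := by
  induction i generalizing x with
  | zero =>
    obtain ⟨a, ha, h, -⟩ := exists_cfDigit_cons hx
    exact ⟨a, ha, h⟩
  | succ i ih =>
    obtain ⟨-, -, -, y, hy, -, h⟩ := exists_cfDigit_cons hx
    rw [h]; exact ih hy

theorem dimH_digitSet_rpow_le {α : ℝ} (hα : 1 ≤ α) :
    dimH (digitSet fun d => ∀ i, d i ^ α ≤ d (i + 1)) ≤ ENNReal.ofReal (1 / (1 + α)) := by
  refine ENNReal.le_of_forall_pos_le_add fun ε hε _ => ?_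
  have hα' : 0 < 1 + α := by linarith
  set s : ℝ≥0 := Real.toNNReal (1 / (1 + α)) + ε with hs
  have hsv : (s : ℝ) = 1 / (1 + α) + ε := by
    rw [hs, NNReal.coe_add, Real.coe_toNNReal _ (by positivity)]
  change _ ≤ (Real.toNNReal (1 / (1 + α)) : ℝ≥0∞) + (ε : ℝ≥0∞)
  rw [← ENNReal.coe_add, ← hs]
  obtain ⟨M, hM, hsum⟩ := exists_tsum_rpow_tail_le_one (p := s * (1 + α)) (by
    rw [hsv, add_mul, one_div_mul_cancel hα'.ne']
    have : 0 < (ε : ℝ) * (1 + α) := mul_pos (by exact_mod_cast hε) hα'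
    linarith)
  refine (dimH_mono (t := (⋃ k : ℕ, ⋃ c : ℕ, digitSet fun d => ∀ i, d (i + k) = c) ∪
    ⋃ k : ℕ, ⋃ m : {m : ℕ // M ≤ m}, digitSet fun d => PowerGrowth α m fun i => d (i + k)) ?_).trans ?_
  · rintro x ⟨hx, h⟩
    choose a ha hxa using exists_nat_cfDigit_eq hx
    have hmono : Monotone a := monotone_nat_of_le_succ fun i => by
      have := h i
      rw [hxa, hxa] at this
      exact le_of_rpow_le hα (ha i) this
    by_cases hb : ∃ k, M ≤ a k
    · obtain ⟨k, hk⟩ := hb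
      -- The tail starts at `k + 1`, since the digit `a k` itself serves as `m`.
      refine Or.inr (mem_iUnion₂.2 ⟨k + 1, ⟨a k, hk⟩, hx, ?_, fun i => ?_⟩)
      · have := h k
        rw [hxa k] at this
        simpa [Nat.add_comm] using this
      · convert h (i + (k + 1)) using 2; ring
    · push Not at hb
      obtain ⟨k, hk⟩ : ∃ k, ∀ n, k ≤ n → a k = a n := by
        by_contra hne
        push Not at hne
        have : ∀ j, ∃ k, j ≤ a k := fun j => by
          induction j with
          | zero => exact ⟨0, Nat.zero_le _⟩
          | succ j ih =>
            obtain ⟨k, hk⟩ := ih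
            obtain ⟨n, hn, hne⟩ := hne k
            exact ⟨n, hk.trans_lt (lt_of_le_of_ne (hmono hn) hne)⟩
        obtain ⟨k, hk⟩ := this M
        exact absurd hk (not_le.2 (hb k))
      exact Or.inl (mem_iUnion₂.2 ⟨k, a k, hx, fun i => by rw [hxa, ← hk _ (Nat.le_add_left k i)]⟩)
  · rw [dimH_union]
    simp only [dimH_iUnion]
    refine max_le (iSup₂_le fun k c => ?_) (iSup₂_le fun k m => ?_)
    · exact (dimH_digitSet_tail_le (fun d => ∀ i, d i = c) k).trans
        ((dimH_digitSet_const _).trans_le zero_le)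
    · exact (dimH_digitSet_tail_le (PowerGrowth α m) k).trans
        (dimH_digitSet_powerGrowth_le hα hM hsum m.2)

/-! ### Lower bound: Hölder continuity of the mixed radix decoding. -/

/-- The mixed radix digits of `y` with respect to the bases `s 0, s 1, …`, where the `n`-th digit
is shifted to lie between `s n` and `2 * s n`. -/
noncomputable def mixedDigit : ℕ → (ℕ → ℕ) → ℝ → ℕ
  | 0, s, y => s 0 + ⌊s 0 * y⌋₊
  | n + 1, s, y => mixedDigit n (fun i => s (i + 1)) (Int.fract (s 0 * y))

theorem mixedDigit_mem (n : ℕ) {s : ℕ → ℕ} (hs : ∀ i, 2 ≤ s i) {y : ℝ} (hy : y ∈ Ico (0 : ℝ) 1) :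
    s n ≤ mixedDigit n s y ∧ mixedDigit n s y < 2 * s n := by
  induction n generalizing s y with
  | zero =>
    have h0 : (0 : ℝ) < s 0 := by exact_mod_cast (by linarith [hs 0] : 0 < s 0)
    have h : ⌊s 0 * y⌋₊ < s 0 :=
      (Nat.floor_lt (mul_nonneg h0.le hy.1)).2 (by nlinarith [hy.2])
    simp only [mixedDigit]; omega
  | succ n ih => exact ih (fun i => hs (i + 1)) ⟨Int.fract_nonneg _, Int.fract_lt_one _⟩

/-- The number whose continued fraction digits are the mixed radix digits of `y`. -/
noncomputable def cfEncode (s : ℕ → ℕ) (y : ℝ) : ℝ := cfValue fun n => mixedDigit n s y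

theorem cfEncode_eq {s : ℕ → ℕ} (hs : ∀ i, 2 ≤ s i) {y : ℝ} (hy : y ∈ Ico (0 : ℝ) 1) :
    cfEncode s y =
      ((s 0 + ⌊s 0 * y⌋₊ : ℕ) + cfEncode (fun i => s (i + 1)) (Int.fract (s 0 * y)))⁻¹ :=
  cfValue_eq fun n => (hs n).trans (mixedDigit_mem n hs hy).1

theorem cfEncode_mem {s : ℕ → ℕ} (hs : ∀ i, 2 ≤ s i) {y : ℝ} (hy : y ∈ Ico (0 : ℝ) 1) :
    cfEncode s y ∈ Icc (0 : ℝ) (1 / 2) :=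
  have h := fun n => (hs n).trans (mixedDigit_mem n hs hy).1
  ⟨cfValue_nonneg h, cfValue_le_half h⟩

/-- The inverse of `cfEncode s` is Hölder continuous, up to an arbitrarily small error. -/
theorem abs_sub_le_cfEncode {t : ℝ} (ht0 : 0 < t) (ht1 : t ≤ 1) (n : ℕ) :
    ∀ s : ℕ → ℕ, (∀ i, 2 ≤ s i) → (∀ i, (4 * s i * s (i + 1) : ℝ) ^ t ≤ s i) →
    ∀ y ∈ Ico (0 : ℝ) 1, ∀ z ∈ Ico (0 : ℝ) 1,
      |y - z| ≤ 16 * (s 0 : ℝ) ^ t * |cfEncode s y - cfEncode s z| ^ t + (1 / 2) ^ n := by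
  induction n with
  | zero =>
    intro s _ _ y hy z hz
    have h1 : |y - z| ≤ 1 := abs_le.2 ⟨by linarith [hy.1, hz.2], by linarith [hy.2, hz.1]⟩
    have h2 : 0 ≤ 16 * (s 0 : ℝ) ^ t * |cfEncode s y - cfEncode s z| ^ t := by positivity
    rw [pow_zero]; linarith
  | succ n ih =>
    intro s hs hgrow y hy z hz
    have hs0 : (2 : ℝ) ≤ s 0 := by exact_mod_cast hs 0
    have hs' : ∀ i, 2 ≤ s (i + 1) := fun i => hs (i + 1)
    set p := Int.fract (s 0 * y) with hp
    set q := Int.fract (s 0 * z) with hq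
    have hpm : p ∈ Ico (0 : ℝ) 1 := ⟨Int.fract_nonneg _, Int.fract_lt_one _⟩
    have hqm : q ∈ Ico (0 : ℝ) 1 := ⟨Int.fract_nonneg _, Int.fract_lt_one _⟩
    have hIH := ih (fun i => s (i + 1)) hs' (fun i => hgrow (i + 1)) p hpm q hqm
    have hu := cfEncode_mem hs' hpm
    have hv := cfEncode_mem hs' hqm
    have hcy : ⌊s 0 * y⌋₊ < s 0 := (Nat.floor_lt (by nlinarith [hy.1])).2 (by nlinarith [hy.2])
    have hcz : ⌊s 0 * z⌋₊ < s 0 := (Nat.floor_lt (by nlinarith [hz.1])).2 (by nlinarith [hz.2])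
    have ey : (s 0 : ℝ) * y = (⌊s 0 * y⌋₊ : ℝ) + p := by
      rw [hp, natCast_floor_eq_intCast_floor (by nlinarith [hy.1]), Int.floor_add_fract]
    have ez : (s 0 : ℝ) * z = (⌊s 0 * z⌋₊ : ℝ) + q := by
      rw [hq, natCast_floor_eq_intCast_floor (by nlinarith [hz.1]), Int.floor_add_fract]
    rw [cfEncode_eq hs hy, cfEncode_eq hs hz, ← hp, ← hq]
    generalize ⌊s 0 * y⌋₊ = b at *
    generalize ⌊s 0 * z⌋₊ = c at *
    generalize cfEncode (fun i => s (i + 1)) p = u at *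
    generalize cfEncode (fun i => s (i + 1)) q = v at *
    have hb : (b : ℝ) + 1 ≤ s 0 := by exact_mod_cast hcy
    have hc : (c : ℝ) + 1 ≤ s 0 := by exact_mod_cast hcz
    have hb0 : (0 : ℝ) ≤ b := b.cast_nonneg
    have hc0 : (0 : ℝ) ≤ c := c.cast_nonneg
    push_cast
    have pu : 0 < (s 0 : ℝ) + b + u := by linarith [hu.1]
    have pv : 0 < (s 0 : ℝ) + c + v := by linarith [hv.1]
    have hprod : ((s 0 : ℝ) + b + u) * (s 0 + c + v) ≤ 4 * (s 0 : ℝ) ^ 2 := by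
      have h1 : (s 0 : ℝ) + b + u ≤ 2 * s 0 := by linarith [hu.2]
      have h2 : (s 0 : ℝ) + c + v ≤ 2 * s 0 := by linarith [hv.2]
      nlinarith
    have hyz : |y - z| = |((b : ℝ) - c) + (p - q)| / s 0 := by
      rw [eq_div_iff (by positivity), ← abs_of_pos (show (0 : ℝ) < s 0 by linarith), ← abs_mul]
      congr 1; linarith
    rw [abs_inv_add_sub_inv_add pu pv, add_sub_add_left_eq_sub, hyz]
    set D := ((s 0 : ℝ) + b + u) * (s 0 + c + v)
    have hD : 0 < D := mul_pos pu pv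
    -- Equal first digits: pass to the remainders; `hgrow 0` pays for replacing `s 1 ^ t` by `s 0 ^
    -- t`. Distinct first digits: the encoded tails differ by at most `1 / 2`, so they cannot cancel
    -- the digit gap `d`, and both distances compare with `d` directly.
    by_cases hbc : b = c
    · subst hbc
      rw [sub_self, zero_add, zero_add]
      have h1 : |u - v| ≤ 4 * (s 0 : ℝ) ^ 2 * (|u - v| / D) := by
        rw [mul_div_assoc', le_div_iff₀ hD, mul_comm _ D]
        gcongr
      have h2 : |u - v| ^ t ≤ (4 * (s 0 : ℝ) ^ 2) ^ t * (|u - v| / D) ^ t := by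
        rw [← Real.mul_rpow (by positivity) (by positivity)]
        exact Real.rpow_le_rpow (abs_nonneg _) h1 ht0.le
      have h3 : (s 1 : ℝ) ^ t * (4 * (s 0 : ℝ) ^ 2) ^ t ≤ s 0 * (s 0 : ℝ) ^ t := by
        rw [← Real.mul_rpow (by positivity) (by positivity),
          show (s 1 : ℝ) * (4 * (s 0 : ℝ) ^ 2) = (4 * s 0 * s (0 + 1)) * s 0 by ring,
          Real.mul_rpow (by positivity) (by positivity)]
        exact mul_le_mul_of_nonneg_right (hgrow 0) (by positivity)
      rw [div_le_iff₀ (by positivity)]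
      refine hIH.trans ?_
      rw [add_mul]
      refine add_le_add ?_ ?_
      · calc 16 * (s (0 + 1) : ℝ) ^ t * |u - v| ^ t
            ≤ 16 * (s 1 : ℝ) ^ t * ((4 * (s 0 : ℝ) ^ 2) ^ t * (|u - v| / D) ^ t) := by gcongr
          _ = 16 * ((s 1 : ℝ) ^ t * (4 * (s 0 : ℝ) ^ 2) ^ t) * (|u - v| / D) ^ t := by ring
          _ ≤ 16 * (s 0 * (s 0 : ℝ) ^ t) * (|u - v| / D) ^ t := by gcongr
          _ = _ := by ring
      · rw [pow_succ]
        have : (0 : ℝ) < (1 / 2) ^ n := by positivity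
        nlinarith
    · set d := |(b : ℝ) - c| with hd
      have hd1 : 1 ≤ d := by
        have : (1 : ℤ) ≤ |(b : ℤ) - c| := Int.one_le_abs (by omega)
        rw [hd]; exact_mod_cast this
      have hd2 : d ≤ s 0 := abs_le.2 ⟨by linarith, by linarith⟩
      have hup : |(b : ℝ) - c + (p - q)| ≤ 2 * d := by
        have h1 : |p - q| ≤ 1 :=
          abs_le.2 ⟨by linarith [hpm.1, hqm.2], by linarith [hpm.2, hqm.1]⟩
        linarith [abs_add_le ((b : ℝ) - c) (p - q)]
      have hlow : d / 2 ≤ |(b : ℝ) + u - (c + v)| := by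
        have h1 : |u - v| ≤ 1 / 2 :=
          abs_le.2 ⟨by linarith [hu.1, hv.2], by linarith [hu.2, hv.1]⟩
        have h2 := abs_sub_abs_le_abs_sub ((b : ℝ) - c) (v - u)
        rw [abs_sub_comm v u, show (b : ℝ) - c - (v - u) = b + u - (c + v) by ring] at h2
        linarith
      rw [show (b : ℝ) - c + (u - v) = b + u - (c + v) by ring]
      set w := |(b : ℝ) + u - (c + v)| / D with hw
      have h1 : d / s 0 ≤ 8 * s 0 * w := by
        rw [hw, mul_div_assoc', div_le_div_iff₀ (by positivity) hD]
        calc d * D ≤ d * (4 * (s 0 : ℝ) ^ 2) := by gcongr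
          _ = 8 * s 0 * (d / 2) * s 0 := by ring
          _ ≤ _ := by gcongr
      have h2 : d / s 0 ≤ (d / s 0) ^ t :=
        Real.self_le_rpow_of_le_one (by positivity) ((div_le_one (by positivity)).2 hd2) ht1
      have h3 : (d / s 0) ^ t ≤ (8 * s 0 * w) ^ t := Real.rpow_le_rpow (by positivity) h1 ht0.le
      have h4 : (8 : ℝ) ^ t ≤ 8 := Real.rpow_le_self_of_one_le (by norm_num) ht1
      rw [Real.mul_rpow (by positivity) (by positivity), Real.mul_rpow (by positivity) (by positivity)]
        at h3
      calc |(b : ℝ) - c + (p - q)| / s 0 ≤ 2 * d / s 0 := by gcongr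
        _ = 2 * (d / s 0) := by ring
        _ ≤ 2 * (8 * (s 0 : ℝ) ^ t * w ^ t) := by
          gcongr
          exact (h2.trans h3).trans (by gcongr)
        _ = 16 * (s 0 : ℝ) ^ t * w ^ t := by ring
        _ ≤ _ := le_add_of_nonneg_right (by positivity)

/-- A lower bound for the dimension of the set of numbers whose `n`-th digit lies in
`[s n, 2 * s n)`. -/
theorem le_dimH_digitSet_dyadic {t : ℝ≥0} (ht0 : 0 < t) (ht1 : t ≤ 1) {s : ℕ → ℕ}
    (hs : ∀ i, 2 ≤ s i) (hgrow : ∀ i, (4 * s i * s (i + 1) : ℝ) ^ (t : ℝ) ≤ s i) :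
    (t : ℝ≥0∞) ≤ dimH (digitSet fun d => ∀ i, (s i : ℝ) ≤ d i ∧ d i ≤ 2 * s i) := by
  set g := cfEncode s
  have hg : ∀ y ∈ Ico (0 : ℝ) 1, ∀ z ∈ Ico (0 : ℝ) 1,
      |y - z| ≤ 16 * (s 0 : ℝ) ^ (t : ℝ) * |g y - g z| ^ (t : ℝ) := fun y hy z hz => by
    have hlim : Tendsto (fun n : ℕ => 16 * (s 0 : ℝ) ^ (t : ℝ) * |g y - g z| ^ (t : ℝ) + (1 / 2) ^ n)
        atTop (𝓝 (16 * (s 0 : ℝ) ^ (t : ℝ) * |g y - g z| ^ (t : ℝ) + 0)) :=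
      tendsto_const_nhds.add
        (tendsto_pow_atTop_nhds_zero_of_lt_one (by norm_num) (by norm_num))
    rw [add_zero] at hlim
    exact ge_of_tendsto' hlim fun n =>
      abs_sub_le_cfEncode (by exact_mod_cast ht0) (by exact_mod_cast ht1) n s hs hgrow y hy z hz
  have hinj : InjOn g (Ico 0 1) := fun y hy z hz h => by
    have := hg y hy z hz
    rw [h, sub_self, abs_zero, Real.zero_rpow (by exact_mod_cast ht0.ne'), mul_zero] at this
    exact sub_eq_zero.1 (abs_nonpos_iff.1 this)
  have hleft : LeftInvOn (Function.invFunOn g (Ico 0 1)) g (Ico 0 1) := hinj.leftInvOn_invFunOn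
  have hholder : HolderOnWith (16 * (s 0 : ℝ≥0) ^ (t : ℝ)) t (Function.invFunOn g (Ico 0 1))
      (g '' Ico 0 1) := by
    rintro _ ⟨y, hy, rfl⟩ _ ⟨z, hz, rfl⟩
    rw [hleft hy, hleft hz, edist_dist, edist_dist,
      ENNReal.ofReal_rpow_of_nonneg dist_nonneg t.coe_nonneg, ← ENNReal.ofReal_coe_nnreal,
      ← ENNReal.ofReal_mul (NNReal.coe_nonneg _)]
    refine ENNReal.ofReal_le_ofReal ?_
    simpa [Real.dist_eq] using hg y hy z hz
  -- The image is `[0, 1)`, of dimension 1, and a `t`-Hölder map raises dimension by a factor of at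
  -- most `1 / t`.
  have hdim := hholder.dimH_image_le ht0
  rw [hleft.image_image, Real.dimH_of_nonempty_interior (by simp [interior_Ico]),
    Module.finrank_self, Nat.cast_one, ENNReal.le_div_iff_mul_le (by simp [ht0.ne']) (by simp),
    one_mul] at hdim
  refine hdim.trans (dimH_mono ?_)
  rintro _ ⟨y, hy, rfl⟩
  have h2 : ∀ n, 2 ≤ mixedDigit n s y := fun n => (hs n).trans (mixedDigit_mem n hs hy).1
  refine ⟨cfValue_mem_unitIrr h2, fun i => ?_⟩
  have hm := mixedDigit_mem i hs hy
  change (s i : ℝ) ≤ cfDigit (cfValue _) i ∧ cfDigit (cfValue _) i ≤ _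
  rw [cfDigit_cfValue h2]
  exact ⟨by exact_mod_cast hm.1, by exact_mod_cast hm.2.le⟩

/-- Suppose `f n ≤ C * n ^ α`. If `Q` holds for all digit sequences `d` with `s i ≤ d i ≤ 2 * s i`,
where `s` is an orbit of `f`, then `digitSet Q` has dimension at least `1 / (1 + α)`. -/
theorem le_dimH_of_growth {α C : ℝ} (hα : 1 ≤ α) (hC : 1 ≤ C) {f : ℕ → ℕ}
    (hf : ∀ n, 1 ≤ n → n ≤ f n) (hfC : ∀ n, 1 ≤ n → (f n : ℝ) ≤ C * (n : ℝ) ^ α)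
    {Q : (ℕ → ℝ) → Prop}
    (hQ : ∀ (d : ℕ → ℝ) (s : ℕ → ℕ), (∀ i, 2 ≤ s i) → (∀ i, s (i + 1) = f (s i)) →
      (∀ i, (s i : ℝ) ≤ d i ∧ d i ≤ 2 * s i) → Q d) :
    ENNReal.ofReal (1 / (1 + α)) ≤ dimH (digitSet Q) := by
  have hα' : 0 < 1 + α := by linarith
  refine le_of_forall_lt_imp_le_of_dense fun r hr => ?_
  obtain ⟨t, rfl⟩ := ENNReal.lt_iff_exists_coe.1 hr |>.imp fun _ h => h.1
  rcases eq_zero_or_pos t with rfl | ht0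
  · simp
  have htr : (t : ℝ) < 1 / (1 + α) := by
    rw [← ENNReal.ofReal_coe_nnreal, ENNReal.ofReal_lt_ofReal_iff (by positivity)] at hr
    exact hr
  have ht0' : (0 : ℝ) < t := by exact_mod_cast ht0
  have ht1 : t ≤ 1 := by
    have : 1 / (1 + α) ≤ 1 := (div_le_one hα').2 (by linarith)
    exact_mod_cast htr.le.trans this
  have hδ : 0 < 1 - t * (1 + α) := by
    rw [lt_div_iff₀ hα'] at htr; linarith
  -- Since `t * (1 + α) < 1`, a large starting value `N` absorbs the constant `4 * C`.
  obtain ⟨N, hN2, hN⟩ : ∃ N : ℕ, 2 ≤ N ∧ (4 * C) ^ (t : ℝ) ≤ (N : ℝ) ^ (1 - t * (1 + α)) := by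
    have h := (tendsto_rpow_atTop hδ).comp tendsto_natCast_atTop_atTop
    obtain ⟨N, h1, h2⟩ :=
      ((eventually_ge_atTop 2).and (h.eventually_ge_atTop ((4 * C) ^ (t : ℝ)))).exists
    exact ⟨N, h1, h2⟩
  set s : ℕ → ℕ := fun n => f^[n] N with hsdef
  have hsucc : ∀ i, s (i + 1) = f (s i) := fun i => Function.iterate_succ_apply' f i N
  have hsN : ∀ i, N ≤ s i := fun i => by
    induction i with
    | zero => exact le_rfl
    | succ i ih => rw [hsucc]; exact ih.trans (hf _ (by omega))
  have hs2 : ∀ i, 2 ≤ s i := fun i => hN2.trans (hsN i)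
  refine (le_dimH_digitSet_dyadic ht0 ht1 hs2 fun i => ?_).trans
    (dimH_mono fun x hx => ⟨hx.1, hQ _ s hs2 hsucc hx.2⟩)
  have hpos : (0 : ℝ) < s i := by exact_mod_cast (by linarith [hs2 i] : 0 < s i)
  calc (4 * s i * s (i + 1) : ℝ) ^ (t : ℝ) ≤ ((4 * C) * (s i : ℝ) ^ (1 + α)) ^ (t : ℝ) := by
        refine Real.rpow_le_rpow (by positivity) ?_ ht0'.le
        rw [hsucc, Real.rpow_add hpos, Real.rpow_one]
        have := hfC (s i) (by linarith [hs2 i])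
        calc (4 * s i * f (s i) : ℝ) ≤ 4 * s i * (C * (s i : ℝ) ^ α) := by gcongr
          _ = _ := by ring
    _ = (4 * C) ^ (t : ℝ) * (s i : ℝ) ^ (t * (1 + α)) := by
        rw [Real.mul_rpow (by positivity) (by positivity), ← Real.rpow_mul hpos.le, mul_comm (1 + α)]
    _ ≤ (s i : ℝ) ^ (1 - t * (1 + α)) * (s i : ℝ) ^ (t * (1 + α)) := by
        gcongr
        refine hN.trans (Real.rpow_le_rpow (by positivity) ?_ hδ.le)
        exact_mod_cast hsN i
    _ = s i := by rw [← Real.rpow_add hpos, sub_add_cancel, Real.rpow_one]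

/-! ### The two growth conditions. -/

theorem setOf_eq_digitSet (Q : (ℕ → ℝ) → Prop) :
    {x : ℝ | x ∈ Icc (0 : ℝ) 1 ∧ Irrational x ∧ Q (cfDigit x)} = digitSet Q := by
  ext x
  exact ⟨fun h => ⟨mem_unitIrr_of_mem_Icc h.1 h.2.1, h.2.2⟩,
    fun h => ⟨Ioo_subset_Icc_self h.1.1, h.1.2, h.2⟩⟩

theorem dimH_digitSet_linear {β : ℝ} (hβ : 1 ≤ β) :
    dimH (digitSet fun d => ∀ i, β * d i ≤ d (i + 1)) = ENNReal.ofReal (1 / 2) := by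
  apply le_antisymm
  · have h := dimH_digitSet_rpow_le (α := 1) le_rfl
    rw [one_add_one_eq_two] at h
    refine (dimH_mono (t := digitSet fun d => ∀ i, d i ^ (1 : ℝ) ≤ d (i + 1))
      fun x hx => ⟨hx.1, fun i => ?_⟩).trans h
    obtain ⟨a, -, ha⟩ := exists_nat_cfDigit_eq hx.1 i
    have h0 : 0 ≤ cfDigit x i := ha ▸ a.cast_nonneg
    rw [Real.rpow_one]
    exact (le_mul_of_one_le_left h0 hβ).trans (hx.2 i)
  · have hB : 2 * β ≤ ⌈2 * β⌉₊ := Nat.le_ceil _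
    have hB1 : 1 ≤ ⌈2 * β⌉₊ := Nat.one_le_ceil_iff.2 (by linarith)
    -- The factor 2 is needed because `d i` may be as large as `2 * s i`.
    have h := le_dimH_of_growth (α := 1) (C := ⌈2 * β⌉₊) (f := fun n => ⌈2 * β⌉₊ * n)
      (Q := fun d => ∀ i, β * d i ≤ d (i + 1)) le_rfl (by exact_mod_cast hB1)
      (fun n _ => Nat.le_mul_of_pos_left n hB1) (fun n _ => by rw [Real.rpow_one]; push_cast; rfl)
      fun d s _ hs hd i => by
        have h1 := (hd (i + 1)).1
        rw [hs] at h1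
        push_cast at h1
        have h2 := (hd i).2
        have h3 : (0 : ℝ) ≤ s i := (s i).cast_nonneg
        nlinarith
    rwa [one_add_one_eq_two] at h

theorem dimH_digitSet_rpow {α : ℝ} (hα : 1 ≤ α) :
    dimH (digitSet fun d => ∀ i, d i ^ α ≤ d (i + 1)) = ENNReal.ofReal (1 / (1 + α)) := by
  refine le_antisymm (dimH_digitSet_rpow_le hα) ?_
  have hα0 : 0 ≤ α := by linarith
  have hone : ∀ n : ℕ, 1 ≤ n → (1 : ℝ) ≤ (2 * n : ℝ) ^ α := fun n hn =>
    Real.one_le_rpow (by have : (1 : ℝ) ≤ n := by exact_mod_cast hn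
                         linarith) hα0
  -- Again `2 * n` allows for `d i ≤ 2 * s i`. The extra 2 in `C` covers rounding up, as `(2 * n) ^
  -- α ≥ 1`.
  refine le_dimH_of_growth (C := 2 * 2 ^ α) (f := fun n => ⌈(2 * n : ℝ) ^ α⌉₊) hα ?_ ?_ ?_ ?_
  · have : (1 : ℝ) ≤ 2 ^ α := Real.one_le_rpow (by norm_num) hα0
    linarith
  · intro n hn
    have hn1 : (1 : ℝ) ≤ n := by exact_mod_cast hn
    have h1 : (2 * n : ℝ) ≤ (2 * n : ℝ) ^ α := Real.self_le_rpow_of_one_le (by linarith) hα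
    have : (n : ℝ) ≤ ⌈(2 * n : ℝ) ^ α⌉₊ := by linarith [Nat.le_ceil ((2 * n : ℝ) ^ α)]
    exact_mod_cast this
  · intro n hn
    have h1 := Nat.ceil_lt_add_one (show 0 ≤ (2 * n : ℝ) ^ α by positivity)
    have h2 := hone n hn
    rw [mul_assoc, ← Real.mul_rpow (by norm_num) (by positivity)]
    linarith
  · intro d s _ hs hd i
    have h1 := (hd (i + 1)).1
    rw [hs] at h1
    have h3 : (0 : ℝ) ≤ d i := (s i).cast_nonneg.trans (hd i).1
    exact (Real.rpow_le_rpow h3 (hd i).2 hα0).trans ((Nat.le_ceil _).trans h1)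

theorem corollary1 :
    (∀ β : ℝ, 1 ≤ β →
      dimH {x : ℝ | x ∈ Set.Icc (0 : ℝ) 1 ∧ Irrational x ∧
        ∀ i : ℕ, β * cfDigit x i ≤ cfDigit x (i + 1)} = ENNReal.ofReal (1 / 2)) ∧
    (∀ α : ℝ, 1 < α →
      dimH {x : ℝ | x ∈ Set.Icc (0 : ℝ) 1 ∧ Irrational x ∧
        ∀ i : ℕ, cfDigit x i ^ α ≤ cfDigit x (i + 1)} = ENNReal.ofReal (1 / (1 + α))) := by
  refine ⟨fun β hβ => ?_, fun α hα => ?_⟩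
  · rw [setOf_eq_digitSet fun d => ∀ i, β * d i ≤ d (i + 1)]
    exact dimH_digitSet_linear hβ
  · rw [setOf_eq_digitSet fun d => ∀ i, d i ^ α ≤ d (i + 1)]
    exact dimH_digitSet_rpow hα.le
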